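/- Let $N\ge 1$ and let $\mathbb{C}\{0,1\}^N$ be the free complex vector space on the set $\{0,1\}^N$ of binary strings $m$ of length $N$, where the digits $m_0,\dots,m_{N-1}$ of $m$ represent the number $\sum_i m_i2^i$. For a formal sum $c=\sum_{i=0}^{N-1} c_i 2^i$ with $c_i\in\mathbb{Z}$, say that $c$ can be added to $m$ without carrying if every $m_i+c_i$ lies in $\{0,1\}$. The associated arithmetic function $f_c:\{0,1\}^N\to\{0,1\}^N$ sends $m$ to the string with digits $m_i+c_i$ if $c$ can be added to $m$ without carrying, and fixes $m$ otherwise. Let $\overline{c}$ be the linear operator on $\mathbb{C}\{0,1\}^N$ that sends a basis vector $m$ to $f_c(m)$ if $f_c(m)\neq m$, and to $0$ if $f_c(m)=m$. Put $$B^{\pm 1}=\overline{\pm 1},\qquad B^{\pm k}=\overline{\pm 2^{k-1}\mp 2^{k-2}}\quad(2\le k\le N),$$ and let $\mathfrak{g}_N$ be the complex Lie subalgebra of $\operatorname{End}(\mathbb{C}\{0,1\}^N)$, with the commutator bracket, generated by $B^{\pm1},\dots,B^{\pm N}$. The fundamental spin representation of $\mathfrak{so}(2N+1,\mathbb{C})$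 (skew-symmetric complex matrices of size $2N+1$) is the following representation on $\Lambda^\bullet\mathbb{C}^N$. Write $\mathbb{C}^{2N+1}$, with the quadratic form $\sum_i x_i^2$, as $W\oplus W^*\oplus\mathbb{C}$, where $W=\mathbb{C}^N$ and $W^*$ are isotropic and the form is $(w,f,c)\mapsto f(w)+c^2$. The Clifford algebra of $\mathbb{C}^{2N+1}$ (with $v^2$ equal to the value of the form at $v$) acts on $\Lambda^\bullet W$ with $w\in W$ acting by exterior multiplication, $f\in W^*$ by contraction, and $c\in\mathbb{C}$ by $(-1)^{p}c$ on $\Lambda^pW$. A matrix $A\in\mathfrak{so}(2N+1,\mathbb{C})$ acts through the Clifford element $\tfrac14\sum_{i,j}A_{ij}\,e_ie_j$, where $(e_i)$ is the standard basis of $\mathbb{C}^{2N+1}$. Then the Lie algebra $\mathfrak{g}_N$ is isomorphic to $\mathfrak{so}(2N+1,\mathbb{C})$, and its action on $\mathbb{C}\{0,1\}^N$ is equivalent to the fundamental spin representation: there are a Lie algebra isomorphism $\varphi:\mathfrak{g}_N\to\mathfrak{so}(2N+1,\mathbb{C})$ and a linear isomorphism $T:\mathbb{C}\{0,1\}^N\to\Lambda^\bullet\mathbb{C}^N$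 such that $T(Xv)=\varphi(X)\cdot T(v)$ for all $X\in\mathfrak{g}_N$ and $v\in\mathbb{C}\{0,1\}^N$. -/

import Mathlib

attribute [local instance] LieRing.ofAssociativeRing

noncomputable section

namespace BinarySpin

/-! ### Binary strings and carry-free arithmetic operators -/

/-- Fixed width binary numbers with `N` digits; the digit with index `i` is the coefficient
of `2 ^ i`. -/
abbrev BinStr (N : ℕ) : Type := Fin N → Fin 2

/-- The free complex vector space on the set of binary strings of length `N`. -/
abbrev BinSpace (N : ℕ) : Type := BinStr N →₀ ℂ

/-- The formal summand `+ 2 ^ j`, as a vector of digit increments. -/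
def pow2 (N : ℕ) (j : ℕ) : Fin N → ℤ := fun i => if (i : ℕ) = j then 1 else 0

/-- The formal sum `∑ i, c i * 2 ^ i` can be added to `m` without any carrying (or borrowing):
every digit, incremented separately, is still a binary digit. -/
def CarryFree {N : ℕ} (c : Fin N → ℤ) (m : BinStr N) : Prop :=
  ∀ i, ((m i : ℕ) : ℤ) + c i = 0 ∨ ((m i : ℕ) : ℤ) + c i = 1

open Classical in
/-- The arithmetic function `m ↦ m + ∑ i, c i * 2 ^ i`, which fixes `m` whenever carrying
would be needed. -/
def arithFun {N : ℕ} (c : Fin N → ℤ) (m : BinStr N) : BinStr N :=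
  if CarryFree c m then fun i => if ((m i : ℕ) : ℤ) + c i = 1 then 1 else 0 else m

open Classical in
/-- The linear operator attached to a function `f` on binary strings:
`m ↦ 0` if `f m = m`, and `m ↦ f m` otherwise. -/
def overline {N : ℕ} (f : BinStr N → BinStr N) : Module.End ℂ (BinSpace N) :=
  Finsupp.linearCombination ℂ fun m => if f m = m then 0 else Finsupp.single (f m) 1

/-- The formal sums `+ 1` (for `k = 1`) and `+ 2 ^ (k - 1) - 2 ^ (k - 2)` (for `k ≥ 2`). The
value at `k = 0` is not used. -/
def shift (N : ℕ) : ℕ → Fin N → ℤ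
  | 0 => 0
  | 1 => pow2 N 0
  | k + 2 => pow2 N (k + 1) - pow2 N k

/-- The operator `B^k`. -/
def Bpos (N k : ℕ) : Module.End ℂ (BinSpace N) := overline (arithFun (shift N k))

/-- The operator `B^{-k}`. -/
def Bneg (N k : ℕ) : Module.End ℂ (BinSpace N) := overline (arithFun (-shift N k))

/-- The Lie algebra `𝔤_N` generated by the operators `B^{±k}`, `1 ≤ k ≤ N`, under the
commutator bracket. -/
def oddSpinAlgebra (N : ℕ) : LieSubalgebra ℂ (Module.End ℂ (BinSpace N)) :=
  LieSubalgebra.lieSpan ℂ (Module.End ℂ (BinSpace N))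
    {T | ∃ k, 1 ≤ k ∧ k ≤ N ∧ (T = Bpos N k ∨ T = Bneg N k)}

/-! ### The fundamental spin representation of `so(2N+1, ℂ)` -/

/-- The standard quadratic form `x ↦ ∑ i, x i ^ 2` on `ℂⁿ`. -/
def stdForm (n : ℕ) : QuadraticForm ℂ (Fin n → ℂ) :=
  QuadraticMap.weightedSumSquares ℂ fun _ : Fin n => (1 : ℂ)

/-- The image in the Clifford algebra of the `i`-th standard basis vector. -/
def cliffBasis {n : ℕ} (i : Fin n) : CliffordAlgebra (stdForm n) :=
  CliffordAlgebra.ι (stdForm n) (Pi.single i 1)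

theorem cliffBasis_swap {n : ℕ} (i j : Fin n) :
    cliffBasis i * cliffBasis j + cliffBasis j * cliffBasis i =
      algebraMap ℂ (CliffordAlgebra (stdForm n)) (if i = j then 2 else 0) := by
  unfold cliffBasis
  rw [CliffordAlgebra.ι_mul_ι_add_swap]
  congr 1
  simp only [QuadraticMap.polar, stdForm, QuadraticMap.weightedSumSquares_apply, one_smul,
    ← Finset.sum_sub_distrib, Pi.add_apply]
  have h : ∀ x : Fin n, ((Pi.single i (1 : ℂ) : Fin n → ℂ) x + (Pi.single j (1 : ℂ) : Fin n → ℂ) x) *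
      ((Pi.single i (1 : ℂ) : Fin n → ℂ) x + (Pi.single j (1 : ℂ) : Fin n → ℂ) x) -
      (Pi.single i (1 : ℂ) : Fin n → ℂ) x * (Pi.single i (1 : ℂ) : Fin n → ℂ) x -
      (Pi.single j (1 : ℂ) : Fin n → ℂ) x * (Pi.single j (1 : ℂ) : Fin n → ℂ) x =
      if x = i then (if i = j then 2 else 0) else 0 := by
    intro x
    by_cases hi : x = i
    · subst hi
      by_cases hj : x = j
      · subst hj; simp; norm_num
      · simp [hj]
    · simp [Pi.single_apply, hi]
  simp [h]

/-- The linear map `A ↦ (1/4) ∑ i j, A i j • e_i e_j` from matrices to the Clifford algebra. -/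
def spinLin (n : ℕ) : Matrix (Fin n) (Fin n) ℂ →ₗ[ℂ] CliffordAlgebra (stdForm n) where
  toFun A := (1 / 4 : ℂ) • ∑ i, ∑ j, A i j • (cliffBasis i * cliffBasis j)
  map_add' A B := by
    simp only [Matrix.add_apply, add_smul, Finset.sum_add_distrib, smul_add]
  map_smul' c A := by
    simp only [Matrix.smul_apply, smul_assoc, ← Finset.smul_sum, RingHom.id_apply]
    rw [smul_comm]

theorem spinLin_apply {n : ℕ} (A : Matrix (Fin n) (Fin n) ℂ) :
    spinLin n A = (1 / 4 : ℂ) • ∑ i, ∑ j, A i j • (cliffBasis i * cliffBasis j) := rfl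

theorem spinLin_lie_cliffBasis {n : ℕ} (A : Matrix (Fin n) (Fin n) ℂ) (hA : A.transpose = -A)
    (k : Fin n) :
    spinLin n A * cliffBasis k - cliffBasis k * spinLin n A = ∑ i, A i k • cliffBasis i := by
  have key : ∀ i j : Fin n, cliffBasis i * cliffBasis j * cliffBasis k -
      cliffBasis k * (cliffBasis i * cliffBasis j) =
      (if j = k then (2 : ℂ) else 0) • cliffBasis i -
        (if i = k then (2 : ℂ) else 0) • cliffBasis j := by
    intro i j
    have h1 := cliffBasis_swap j k
    have h2 := cliffBasis_swap i k
    rw [Algebra.algebraMap_eq_smul_one] at h1 h2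
    calc _ = cliffBasis i * (cliffBasis j * cliffBasis k + cliffBasis k * cliffBasis j) -
          (cliffBasis i * cliffBasis k + cliffBasis k * cliffBasis i) * cliffBasis j := by
          noncomm_ring
      _ = _ := by rw [h1, h2]; simp
  have hA' : ∀ i j, A j i = -A i j := fun i j => by
    have := congrFun (congrFun hA i) j
    simpa using this
  rw [spinLin_apply, smul_mul_assoc, mul_smul_comm, ← smul_sub, Finset.sum_mul, Finset.mul_sum,
    ← Finset.sum_sub_distrib]
  simp only [Finset.sum_mul, Finset.mul_sum, ← Finset.sum_sub_distrib, smul_mul_assoc,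
    mul_smul_comm, ← smul_sub, key]
  simp only [smul_sub, Finset.sum_sub_distrib, smul_smul]
  have e1 : ∑ i, ∑ j, (A i j * (if j = k then (2 : ℂ) else 0)) • cliffBasis i =
      (2 : ℂ) • ∑ i, A i k • cliffBasis i := by
    rw [Finset.smul_sum]
    refine Finset.sum_congr rfl fun i _ => ?_
    simp [smul_smul, mul_comm]
  have e2 : ∑ i, ∑ j, (A i j * (if i = k then (2 : ℂ) else 0)) • cliffBasis j =
      -((2 : ℂ) • ∑ i, A i k • cliffBasis i) := by
    rw [Finset.sum_comm, Finset.smul_sum, ← Finset.sum_neg_distrib]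
    refine Finset.sum_congr rfl fun i _ => ?_
    simp [smul_smul, mul_comm, hA' i k]
  rw [e1, e2]
  module

theorem sum_mul_smul {n : ℕ} {M : Type*} [AddCommGroup M] [Module ℂ M]
    (A B : Matrix (Fin n) (Fin n) ℂ) (F : Fin n → Fin n → M) :
    ∑ i, ∑ l, (A * B) i l • F i l = ∑ k, ∑ l, ∑ i, (B k l * A i k) • F i l := by
  calc ∑ i, ∑ l, (A * B) i l • F i l
      = ∑ i, ∑ l, ∑ k, (B k l * A i k) • F i l := by
        simp only [Matrix.mul_apply, Finset.sum_smul, mul_comm]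
    _ = ∑ i, ∑ k, ∑ l, (B k l * A i k) • F i l :=
        Finset.sum_congr rfl fun i _ => Finset.sum_comm
    _ = ∑ k, ∑ i, ∑ l, (B k l * A i k) • F i l := Finset.sum_comm
    _ = ∑ k, ∑ l, ∑ i, (B k l * A i k) • F i l :=
        Finset.sum_congr rfl fun k _ => Finset.sum_comm

theorem sum_mul_smul' {n : ℕ} {M : Type*} [AddCommGroup M] [Module ℂ M]
    (A B : Matrix (Fin n) (Fin n) ℂ) (hA : A.transpose = -A) (F : Fin n → Fin n → M) :
    -∑ k, ∑ i, (B * A) k i • F k i = ∑ k, ∑ l, ∑ i, (B k l * A i l) • F k i := by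
  have hA' : ∀ i j, A j i = -A i j := fun i j => by
    have := congrFun (congrFun hA i) j
    simpa using this
  rw [← Finset.sum_neg_distrib]
  refine Finset.sum_congr rfl fun k _ => ?_
  rw [← Finset.sum_neg_distrib, Finset.sum_comm]
  refine Finset.sum_congr rfl fun i _ => ?_
  rw [Matrix.mul_apply, Finset.sum_smul, ← Finset.sum_neg_distrib]
  refine Finset.sum_congr rfl fun l _ => ?_
  rw [hA' i l, mul_neg, neg_smul, neg_neg]

theorem spinLin_lie {n : ℕ} (A B : Matrix (Fin n) (Fin n) ℂ) (hA : A.transpose = -A) :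
    spinLin n (A * B - B * A) = spinLin n A * spinLin n B - spinLin n B * spinLin n A := by
  have key : ∀ k l : Fin n, spinLin n A * (cliffBasis k * cliffBasis l) -
      cliffBasis k * cliffBasis l * spinLin n A =
      (∑ i, A i k • cliffBasis i) * cliffBasis l +
        cliffBasis k * ∑ i, A i l • cliffBasis i := by
    intro k l
    rw [← spinLin_lie_cliffBasis A hA, ← spinLin_lie_cliffBasis A hA]
    noncomm_ring
  rw [spinLin_apply B, mul_smul_comm, smul_mul_assoc, ← smul_sub, Finset.mul_sum,
    Finset.sum_mul, ← Finset.sum_sub_distrib]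
  simp only [Finset.sum_mul, Finset.mul_sum, ← Finset.sum_sub_distrib, smul_mul_assoc,
    mul_smul_comm, ← smul_sub, key]
  rw [map_sub, spinLin_apply, spinLin_apply, ← smul_sub]
  congr 1
  simp only [smul_add, Finset.smul_sum, Finset.sum_add_distrib, smul_smul]
  rw [sub_eq_add_neg]
  exact congrArg₂ (· + ·) (sum_mul_smul A B fun i l => cliffBasis i * cliffBasis l)
    (sum_mul_smul' A B hA fun k i => cliffBasis k * cliffBasis i)

/-- The standard embedding `so(n, ℂ) → Cl(ℂⁿ)`, `A ↦ (1/4) ∑ i j, A i j • e_i e_j`. It is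
characterised by `[spinEmbedding A, v] = A v` for vectors `v`. -/
def spinEmbedding (n : ℕ) :
    LieAlgebra.Orthogonal.so (Fin n) ℂ →ₗ⁅ℂ⁆ CliffordAlgebra (stdForm n) where
  toLinearMap := (spinLin n).comp (LieAlgebra.Orthogonal.so (Fin n) ℂ).toSubmodule.subtype
  map_lie' := by
    rintro ⟨A, hA⟩ ⟨B, hB⟩
    rw [LieAlgebra.Orthogonal.mem_so] at hA
    exact spinLin_lie A B hA

/-- The spinor space: the exterior algebra of `ℂ^N`. -/
abbrev SpinorSpace (N : ℕ) : Type := ExteriorAlgebra ℂ (Fin N → ℂ)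

/-- The Clifford action on spinors of a vector `w + f + c` of `W ⊕ W* ⊕ ℂ`, where `W = ℂ^N`:
exterior multiplication by `w`, plus contraction with `f`, plus `c` times the grading operator
(`+1` on even forms and `-1` on odd forms). -/
def cliffordOp {N : ℕ} (w : Fin N → ℂ) (f : Module.Dual ℂ (Fin N → ℂ)) (c : ℂ) :
    Module.End ℂ (SpinorSpace N) :=
  LinearMap.mulLeft ℂ (ExteriorAlgebra.ι ℂ w) + CliffordAlgebra.contractLeft f +
    c • CliffordAlgebra.involute.toLinearMap

theorem involute_contractLeft {N : ℕ} (f : Module.Dual ℂ (Fin N → ℂ)) (x : SpinorSpace N) :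
    CliffordAlgebra.involute (CliffordAlgebra.contractLeft f x) =
      -CliffordAlgebra.contractLeft f (CliffordAlgebra.involute x) := by
  induction x using CliffordAlgebra.left_induction with
  | algebraMap r => simp [CliffordAlgebra.contractLeft_algebraMap]
  | add x y hx hy => simp only [map_add, hx, hy, neg_add]
  | ι_mul x m hx =>
    rw [CliffordAlgebra.contractLeft_ι_mul, map_mul, map_sub, map_smul, map_mul, hx,
      CliffordAlgebra.involute_ι, neg_mul, neg_mul, LinearMap.map_neg,
      CliffordAlgebra.contractLeft_ι_mul]
    simp

theorem cliffordOp_sq {N : ℕ} (w : Fin N → ℂ) (f : Module.Dual ℂ (Fin N → ℂ)) (c : ℂ) :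
    cliffordOp w f c * cliffordOp w f c =
      algebraMap ℂ (Module.End ℂ (SpinorSpace N)) (f w + c ^ 2) := by
  refine LinearMap.ext fun x => ?_
  have hw : ∀ y : SpinorSpace N, ExteriorAlgebra.ι ℂ w * (ExteriorAlgebra.ι ℂ w * y) = 0 := by
    intro y
    rw [← mul_assoc, ExteriorAlgebra.ι_sq_zero, zero_mul]
  have hc : ∀ y : SpinorSpace N, CliffordAlgebra.contractLeft f (ExteriorAlgebra.ι ℂ w * y) =
      f w • y - ExteriorAlgebra.ι ℂ w * CliffordAlgebra.contractLeft f y :=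
    fun y => CliffordAlgebra.contractLeft_ι_mul (Q := 0) (d := f) w y
  have hi : ∀ y : SpinorSpace N, CliffordAlgebra.involute (ExteriorAlgebra.ι ℂ w * y) =
      -(ExteriorAlgebra.ι ℂ w * CliffordAlgebra.involute y) := by
    intro y
    rw [map_mul]
    erw [CliffordAlgebra.involute_ι]
    rw [neg_mul]
  have hii : ∀ y : SpinorSpace N, CliffordAlgebra.involute (CliffordAlgebra.involute y) = y :=
    CliffordAlgebra.involute_involute
  simp only [cliffordOp, Module.End.mul_apply, LinearMap.add_apply, LinearMap.smul_apply,
    LinearMap.mulLeft_apply, AlgHom.toLinearMap_apply, map_add, mul_add,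
    Algebra.mul_smul_comm, Module.algebraMap_end_apply, hw, hc, hi, hii,
    CliffordAlgebra.contractLeft_contractLeft, involute_contractLeft]
  module

/-- The coordinate with index `2k` of `ℂ^{2N+1}`. -/
def evenIdx {N : ℕ} (k : Fin N) : Fin (2 * N + 1) := ⟨2 * (k : ℕ), by have := k.isLt; omega⟩

/-- The coordinate with index `2k + 1` of `ℂ^{2N+1}`. -/
def oddIdx {N : ℕ} (k : Fin N) : Fin (2 * N + 1) := ⟨2 * (k : ℕ) + 1, by have := k.isLt; omega⟩

/-- The component in `W = ℂ^N` of a vector of `ℂ^{2N+1}`, for the decomposition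
`ℂ^{2N+1} = W ⊕ W* ⊕ ℂ` into two maximal isotropic subspaces, paired with each other, and a
nondegenerate line. -/
def isoW (N : ℕ) : (Fin (2 * N + 1) → ℂ) →ₗ[ℂ] (Fin N → ℂ) :=
  LinearMap.pi fun k =>
    LinearMap.proj (evenIdx k) +
      Complex.I • LinearMap.proj (oddIdx k)

/-- The component in `W*` of a vector of `ℂ^{2N+1}`. -/
def isoWDual (N : ℕ) : (Fin (2 * N + 1) → ℂ) →ₗ[ℂ] Module.Dual ℂ (Fin N → ℂ) :=
  ∑ k : Fin N,
    ((LinearMap.proj (evenIdx k) : (Fin (2 * N + 1) → ℂ) →ₗ[ℂ] ℂ) -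
      Complex.I • LinearMap.proj (oddIdx k)).smulRight
      (LinearMap.proj k : Module.Dual ℂ (Fin N → ℂ))

theorem isoWDual_apply_isoW {N : ℕ} (x : Fin (2 * N + 1) → ℂ) :
    isoWDual N x (isoW N x) + x (Fin.last (2 * N)) ^ 2 = stdForm (2 * N + 1) x := by
  have hsum : ∀ (M : ℕ) (g : ℕ → ℂ), ∑ i ∈ Finset.range (2 * M), g i =
      ∑ k ∈ Finset.range M, (g (2 * k) + g (2 * k + 1)) := by
    intro M g
    induction M with
    | zero => simp
    | succ M ih =>
      rw [show 2 * (M + 1) = 2 * M + 1 + 1 by ring, Finset.sum_range_succ, Finset.sum_range_succ,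
        ih, Finset.sum_range_succ, add_assoc]
  have h1 : stdForm (2 * N + 1) x = ∑ i : Fin (2 * N + 1), x i * x i := by
    simp [stdForm, QuadraticMap.weightedSumSquares_apply]
  rw [h1, Fin.sum_univ_castSucc]
  have h2 : ∑ i : Fin (2 * N), x i.castSucc * x i.castSucc =
      ∑ k : Fin N, (x (evenIdx k) ^ 2 +
        x (oddIdx k) ^ 2) := by
    have := hsum N fun i => if h : i < 2 * N + 1 then x ⟨i, h⟩ ^ 2 else 0
    rw [Finset.sum_range, Finset.sum_range] at this
    convert this using 1
    · refine Finset.sum_congr rfl fun i _ => ?_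
      rw [dif_pos (by have := i.isLt; omega), sq]
      rfl
    · refine Finset.sum_congr rfl fun k _ => ?_
      rw [dif_pos (by have := k.isLt; omega), dif_pos (by have := k.isLt; omega)]
      rfl
  rw [h2, sq]
  congr 1
  simp only [isoWDual, isoW, LinearMap.sum_apply, LinearMap.smulRight_apply, LinearMap.smul_apply,
    LinearMap.sub_apply, LinearMap.proj_apply, LinearMap.pi_apply, LinearMap.add_apply, smul_eq_mul]
  refine Finset.sum_congr rfl fun k _ => ?_
  linear_combination (-(x (oddIdx k) ^ 2)) * Complex.I_sq

/-- The action of vectors of `ℂ^{2N+1}` on spinors. -/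
def gammaLin (N : ℕ) : (Fin (2 * N + 1) → ℂ) →ₗ[ℂ] Module.End ℂ (SpinorSpace N) where
  toFun x := cliffordOp (isoW N x) (isoWDual N x) (x (Fin.last (2 * N)))
  map_add' x y := by
    ext z
    simp [cliffordOp, add_mul]
    module
  map_smul' r x := by
    ext z
    simp [cliffordOp]
    module

/-- The spinor space as a module over the Clifford algebra of `ℂ^{2N+1}`. -/
def cliffordRep (N : ℕ) :
    CliffordAlgebra (stdForm (2 * N + 1)) →ₐ[ℂ] Module.End ℂ (SpinorSpace N) :=
  CliffordAlgebra.lift (stdForm (2 * N + 1))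
    ⟨gammaLin N, fun x => by rw [← isoWDual_apply_isoW]; exact cliffordOp_sq _ _ _⟩

/-- The fundamental spin representation of `so(2N+1, ℂ)` (skew-symmetric matrices) on the
exterior algebra of `ℂ^N`. -/
def spinRep (N : ℕ) :
    LieAlgebra.Orthogonal.so (Fin (2 * N + 1)) ℂ →ₗ⁅ℂ⁆ Module.End ℂ (SpinorSpace N) :=
  (cliffordRep N : CliffordAlgebra (stdForm (2 * N + 1)) →ₗ⁅ℂ⁆ Module.End ℂ (SpinorSpace N)).comp
    (spinEmbedding (2 * N + 1))

end BinarySpin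

end

noncomputable section

namespace BinarySpin

variable {N : ℕ}

/-! ### Fermionic operators on binary strings -/

/-! This is the Jordan–Wigner picture: a binary string records which of `N` fermionic modes are
occupied, so strings index a basis of the Fock space `Λ ℂ^N`. With a sign counting the occupied
digits above position `i`, the operators `raise i`, `lower i` satisfy the canonical anticommutation
relations, and `parity` anticommutes with each of them. `spinorToBin` matches them with exterior
multiplication, contraction and the grading involution.

The signs disappear from the generators. For `k ≥ 2`, `B^{±k}` hops a particle between adjacent
positions (`Bpos_add_two`, `Bneg_add_two`), while `B^{±1}` is, up to sign, `raise 0` or `lower 0`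
times `parity` (`Bpos_one`, `Bneg_one`). Counting the digits above, not below, is what makes
`parity` cancel the sign at position 0.

Transported to spinors, the generators are combinations of products `γ_i γ_j` with `i ≠ j`, and
these products span the image of the spin representation. Conversely, brackets with the hops carry
the products with `γ_last` from position 0 to every position (`mul_last_mem`), and brackets of the
elements `γ_i γ_last` give all `γ_i γ_j` (`mul_mem`). Hence conjugation carries `𝔤_N` onto the image
of `spinRep` (`map_oddSpinAlgebra`), and `spinRep` is injective (`spinRep_injective`). -/

/-- The sign `(-1) ^ d` of a binary digit `d`. -/
def digitSign (d : Fin 2) : ℂ := if d = 0 then 1 else -1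

theorem digitSign_mul_self (d : Fin 2) : digitSign d * digitSign d = 1 := by
  unfold digitSign; split_ifs <;> norm_num

theorem digitSign_of_ne {d e : Fin 2} (h : d ≠ e) : digitSign d = -digitSign e := by
  revert h; unfold digitSign
  fin_cases d <;> fin_cases e <;> simp

/-- The Jordan–Wigner sign: the parity of the digits above position `i`. -/
def upperSign (i : Fin N) (m : BinStr N) : ℂ := ∏ j ∈ Finset.Ioi i, digitSign (m j)

theorem upperSign_mul_self (i : Fin N) (m : BinStr N) : upperSign i m * upperSign i m = 1 := by
  simp [upperSign, ← Finset.prod_mul_distrib, digitSign_mul_self]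

theorem upperSign_update_of_le {i j : Fin N} (h : j ≤ i) (m : BinStr N) (d : Fin 2) :
    upperSign i (Function.update m j d) = upperSign i m := by
  refine Finset.prod_congr rfl fun l hl => ?_
  rw [Function.update_of_ne]
  rintro rfl
  exact absurd (Finset.mem_Ioi.1 hl) (not_lt.2 h)

theorem prod_digitSign_update {s : Finset (Fin N)} {j : Fin N} (h : j ∈ s) {m : BinStr N}
    {d : Fin 2} (hd : d ≠ m j) :
    ∏ l ∈ s, digitSign (Function.update m j d l) = -∏ l ∈ s, digitSign (m l) := by
  rw [← Finset.mul_prod_erase s _ h, ← Finset.mul_prod_erase s (fun l => digitSign (m l)) h,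
    Function.update_self, digitSign_of_ne hd, neg_mul]
  congr 2
  refine Finset.prod_congr rfl fun l hl => ?_
  rw [Function.update_of_ne (Finset.ne_of_mem_erase hl)]

theorem upperSign_update_of_lt {i j : Fin N} (h : i < j) {m : BinStr N} {d : Fin 2}
    (hd : d ≠ m j) : upperSign i (Function.update m j d) = -upperSign i m :=
  prod_digitSign_update (Finset.mem_Ioi.2 h) hd

/-- The creation operator at position `i`. -/
def raise (i : Fin N) : Module.End ℂ (BinSpace N) :=
  Finsupp.linearCombination ℂ fun m =>
    if m i = 0 then Finsupp.single (Function.update m i 1) (upperSign i m) else 0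

/-- The annihilation operator at position `i`. -/
def lower (i : Fin N) : Module.End ℂ (BinSpace N) :=
  Finsupp.linearCombination ℂ fun m =>
    if m i = 1 then Finsupp.single (Function.update m i 0) (upperSign i m) else 0

/-- The parity operator. -/
def parity : Module.End ℂ (BinSpace N) :=
  Finsupp.linearCombination ℂ fun m => Finsupp.single m (∏ j, digitSign (m j))

theorem raise_single (i : Fin N) (m : BinStr N) (c : ℂ) : raise i (Finsupp.single m c) =
    if m i = 0 then Finsupp.single (Function.update m i 1) (c * upperSign i m) else 0 := by
  simp [raise, Finsupp.linearCombination_single]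

theorem lower_single (i : Fin N) (m : BinStr N) (c : ℂ) : lower i (Finsupp.single m c) =
    if m i = 1 then Finsupp.single (Function.update m i 0) (c * upperSign i m) else 0 := by
  simp [lower, Finsupp.linearCombination_single]

theorem parity_single (m : BinStr N) (c : ℂ) : parity (Finsupp.single m c) =
    Finsupp.single m (c * ∏ j, digitSign (m j)) := by
  simp [parity, Finsupp.linearCombination_single]

theorem end_ext {f g : Module.End ℂ (BinSpace N)}
    (h : ∀ m, f (Finsupp.single m 1) = g (Finsupp.single m 1)) : f = g :=
  Finsupp.lhom_ext' fun m => LinearMap.ext_ring (h m)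

/-- Filling the higher position `j` flips the sign seen from `i`, while filling `i` leaves the sign
seen from `j` alone; the two orders therefore differ by exactly one sign. -/
theorem raise_mul_raise_of_lt {i j : Fin N} (h : i < j) :
    raise i * raise j = -(raise j * raise i) := by
  refine end_ext fun m => ?_
  simp only [Module.End.mul_apply, LinearMap.neg_apply, raise_single]
  by_cases hi : m i = 0 <;> by_cases hj : m j = 0 <;>
    simp [raise_single, hi, hj, h.ne, h.ne', upperSign_update_of_le h.le,
      upperSign_update_of_lt h, Function.update_comm h.ne, mul_comm]

theorem raise_mul_raise (i j : Fin N) : raise i * raise j = -(raise j * raise i) := by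
  rcases lt_trichotomy i j with h | rfl | h
  · exact raise_mul_raise_of_lt h
  · refine end_ext fun m => ?_
    by_cases hi : m i = 0 <;> simp [Module.End.mul_apply, raise_single, hi]
  · rw [raise_mul_raise_of_lt h]
    exact (neg_neg (raise i * raise j)).symm

theorem fin_two_ne_zero {d : Fin 2} (h : d ≠ 0) : d = 1 := by omega

/-- For `i = j` exactly one of the two products survives on each string, and its sign is a square.
For `i ≠ j` the one-sided sign flip makes the two orders cancel. -/
theorem lower_mul_raise (i j : Fin N) :
    lower i * raise j + raise j * lower i = if i = j then 1 else 0 := by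
  refine end_ext fun m => ?_
  simp only [Module.End.mul_apply, LinearMap.add_apply, raise_single, lower_single]
  rcases lt_trichotomy i j with h | rfl | h
  · by_cases hi : m i = 0 <;> by_cases hj : m j = 0 <;>
      simp [raise_single, lower_single, hi, hj, h.ne, h.ne', upperSign_update_of_le h.le,
        upperSign_update_of_lt h, Function.update_comm h.ne, mul_comm, fin_two_ne_zero]
  · by_cases hi : m i = 0
    · have hu : Function.update m i 0 = m := by rw [← hi, Function.update_eq_self]
      simp [lower_single, hi, upperSign_update_of_le, upperSign_mul_self, hu]
    · have hi := fin_two_ne_zero hi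
      have hu : Function.update m i 1 = m := by rw [← hi, Function.update_eq_self]
      simp [raise_single, hi, upperSign_update_of_le, upperSign_mul_self, hu]
  · by_cases hi : m i = 0 <;> by_cases hj : m j = 0 <;>
      simp [raise_single, lower_single, hi, hj, h.ne, h.ne', upperSign_update_of_le h.le,
        upperSign_update_of_lt h, Function.update_comm h.ne, mul_comm, fin_two_ne_zero]

theorem parity_mul_raise (i : Fin N) : parity * raise i = -(raise i * parity) := by
  refine end_ext fun m => ?_
  by_cases hi : m i = 0
  · simp [Module.End.mul_apply, raise_single, parity_single, hi, prod_digitSign_update, mul_comm]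
  · simp [Module.End.mul_apply, raise_single, parity_single, hi]

/-! ### The operators `B^{±k}` in terms of the fermionic operators -/

/-- The digits of `m'` certify the absence of carrying; `hm` excludes a fixed string, which
`overline` would kill. -/
theorem overline_arithFun_single {c : Fin N → ℤ} {m m' : BinStr N}
    (h : ∀ i, ((m' i : ℕ) : ℤ) = ((m i : ℕ) : ℤ) + c i) (hm : m' ≠ m) :
    overline (arithFun c) (Finsupp.single m 1) = Finsupp.single m' 1 := by
  have hc : CarryFree c m := fun i => by rw [← h i]; have := (m' i).isLt; omega
  have ha : arithFun c m = m' := by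
    rw [arithFun, if_pos hc]
    funext i
    rw [← h i]
    generalize m' i = d
    fin_cases d <;> simp
  simp [overline, Finsupp.linearCombination_single, ha, hm]

theorem overline_arithFun_single_of_not {c : Fin N → ℤ} {m : BinStr N} (h : ¬ CarryFree c m) :
    overline (arithFun c) (Finsupp.single m 1) = 0 := by
  simp [overline, Finsupp.linearCombination_single, arithFun, h]

theorem prod_digitSign_eq_upperSign [NeZero N] (m : BinStr N) :
    ∏ j, digitSign (m j) = digitSign (m 0) * upperSign 0 m := by
  rw [← Finset.mul_prod_erase _ _ (Finset.mem_univ 0), upperSign]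
  congr 2
  ext j
  simp [Fin.pos_iff_ne_zero]

theorem update_ne_self {m : BinStr N} {i : Fin N} {d : Fin 2} (h : d ≠ m i) :
    Function.update m i d ≠ m := fun e => h (by simpa using congrFun e i)

/-- When digit 0 is 0, the parity of the whole string equals the sign carried by `raise 0`, so the
two multiply to 1. -/
theorem Bpos_one [NeZero N] : Bpos N 1 = raise 0 * parity := by
  refine end_ext fun m => ?_
  rw [Module.End.mul_apply, parity_single, raise_single, prod_digitSign_eq_upperSign, one_mul]
  by_cases h : m 0 = 0
  · rw [if_pos h, h, mul_assoc, upperSign_mul_self]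
    rw [Bpos, overline_arithFun_single (m' := Function.update m 0 1) _
      (update_ne_self (by simp [h]))]
    · simp [digitSign]
    · intro i
      by_cases hi : i = 0
      · subst hi; simp [h, shift, pow2]
      · have : (i : ℕ) ≠ 0 := fun e => hi (Fin.ext e)
        simp [hi, shift, pow2, this]
  · rw [if_neg h, Bpos, overline_arithFun_single_of_not]
    intro hc
    have := hc 0
    simp [shift, pow2, fin_two_ne_zero h] at this

/-- Here digit 0 is 1 and contributes an extra `-1` to the parity, whence the minus sign. -/
theorem Bneg_one [NeZero N] : Bneg N 1 = -(lower 0 * parity) := by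
  refine end_ext fun m => ?_
  rw [LinearMap.neg_apply, Module.End.mul_apply, parity_single, lower_single,
    prod_digitSign_eq_upperSign, one_mul]
  by_cases h : m 0 = 1
  · rw [if_pos h, h, mul_assoc, upperSign_mul_self]
    rw [Bneg, overline_arithFun_single (m' := Function.update m 0 0) _
      (update_ne_self (by simp [h]))]
    · simp [digitSign]
    · intro i
      by_cases hi : i = 0
      · subst hi; simp [h, shift, pow2]
      · have : (i : ℕ) ≠ 0 := fun e => hi (Fin.ext e)
        simp [hi, shift, pow2, this]
  · rw [if_neg h, Bneg, overline_arithFun_single_of_not, neg_zero]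
    intro hc
    have := hc 0
    have h0 : m 0 = 0 := by omega
    simp [shift, pow2, h0] at this

theorem upperSign_succ {i j : Fin N} (hij : (j : ℕ) = i + 1) (m : BinStr N) :
    upperSign i m = digitSign (m j) * upperSign j m := by
  have : Finset.Ioi i = insert j (Finset.Ioi j) := by
    ext l
    simp only [Finset.mem_Ioi, Finset.mem_insert, Fin.lt_def, Fin.ext_iff]
    omega
  rw [upperSign, this, Finset.prod_insert (by simp), upperSign]

theorem shift_add_two {i j : Fin N} (hij : (j : ℕ) = i + 1) (l : Fin N) :
    shift N (i + 2) l = (if l = j then 1 else 0) - if l = i then 1 else 0 := by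
  simp [shift, pow2, Fin.ext_iff, hij]

/-- By adjacency the signs at `i` and `j` differ only by the sign of digit `j`, which is 0 when
`lower i` acts, so they cancel. -/
theorem Bpos_add_two {i j : Fin N} (hij : (j : ℕ) = i + 1) :
    Bpos N (i + 2) = raise j * lower i := by
  have hlt : i < j := by rw [Fin.lt_def]; omega
  refine end_ext fun m => ?_
  rw [Module.End.mul_apply, lower_single]
  by_cases hi : m i = 1
  · by_cases hj : m j = 0
    · rw [if_pos hi, raise_single, if_pos (by simp [hlt.ne', hj]), upperSign_succ hij,
        upperSign_update_of_le hlt.le, one_mul, mul_assoc, upperSign_mul_self, hj, Bpos,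
        overline_arithFun_single (m' := Function.update (Function.update m i 0) j 1)]
      · simp [digitSign]
      · intro l
        rw [shift_add_two hij]
        by_cases hlj : l = j
        · subst hlj; simp [hj, hlt.ne']
        · by_cases hli : l = i
          · subst hli; simp [hlt.ne, hi]
          · simp [hlj, hli]
      · intro e
        have := congrFun e j
        simp [hj] at this
    · rw [if_pos hi, raise_single, if_neg (by simpa [hlt.ne'] using hj), Bpos,
        overline_arithFun_single_of_not]
      intro hc
      have := hc j
      simp [shift_add_two hij, fin_two_ne_zero hj, hlt.ne'] at this
  · rw [if_neg hi, map_zero, Bpos, overline_arithFun_single_of_not]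
    intro hc
    have := hc i
    have h0 : m i = 0 := by omega
    simp [shift_add_two hij, h0, hlt.ne] at this

/-- Again digit `j` is 0 at the moment that matters: `lower j` has emptied it before `raise i` reads
its sign. -/
theorem Bneg_add_two {i j : Fin N} (hij : (j : ℕ) = i + 1) :
    Bneg N (i + 2) = raise i * lower j := by
  have hlt : i < j := by rw [Fin.lt_def]; omega
  refine end_ext fun m => ?_
  rw [Module.End.mul_apply, lower_single]
  by_cases hj : m j = 1
  · by_cases hi : m i = 0
    · rw [if_pos hj, raise_single, if_pos (by simp [hlt.ne, hi]), upperSign_succ hij,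
        upperSign_update_of_le le_rfl, Function.update_self, one_mul, mul_left_comm,
        upperSign_mul_self, Bneg,
        overline_arithFun_single (m' := Function.update (Function.update m j 0) i 1)]
      · simp [digitSign]
      · intro l
        rw [Pi.neg_apply, shift_add_two hij]
        by_cases hlj : l = j
        · subst hlj; simp [hj, hlt.ne']
        · by_cases hli : l = i
          · subst hli; simp [hlt.ne, hi]
          · simp [hlj, hli]
      · intro e
        have := congrFun e i
        simp [hi] at this
    · rw [if_pos hj, raise_single, if_neg (by simpa [hlt.ne] using hi), Bneg,
        overline_arithFun_single_of_not]
      intro hc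
      have := hc i
      simp [shift_add_two hij, fin_two_ne_zero hi, hlt.ne] at this
  · rw [if_neg hj, map_zero, Bneg, overline_arithFun_single_of_not]
    intro hc
    have := hc j
    have h0 : m j = 0 := by omega
    simp [shift_add_two hij, h0, hlt.ne'] at this

/-! ### The isomorphism between spinors and binary strings -/

/-- The creation operator of a vector. -/
def raiseLin (N : ℕ) : (Fin N → ℂ) →ₗ[ℂ] Module.End ℂ (BinSpace N) :=
  Fintype.linearCombination ℂ raise

theorem raiseLin_apply (w : Fin N → ℂ) : raiseLin N w = ∑ i, w i • raise i := rfl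

/-- Exchanging the two summation indices shows that the square equals its own negative. -/
theorem sum_smul_mul_self_eq_zero {A ι : Type*} [Fintype ι] [Ring A] [Algebra ℂ A] {a : ι → A}
    (h : ∀ i j, a i * a j = -(a j * a i)) (w : ι → ℂ) :
    (∑ i, w i • a i) * ∑ i, w i • a i = 0 := by
  have : IsAddTorsionFree A := .of_isTorsionFree ℂ A
  refine self_eq_neg.1 ?_
  conv_lhs => rw [Finset.sum_mul_sum, Finset.sum_comm]
  rw [Finset.sum_mul_sum, ← Finset.sum_neg_distrib]
  refine Finset.sum_congr rfl fun i _ => ?_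
  rw [← Finset.sum_neg_distrib]
  refine Finset.sum_congr rfl fun j _ => ?_
  rw [smul_mul_smul_comm, smul_mul_smul_comm, h j i, smul_neg, mul_comm (w j)]

theorem raiseLin_mul_self (w : Fin N → ℂ) : raiseLin N w * raiseLin N w = 0 :=
  sum_smul_mul_self_eq_zero (A := Module.End ℂ (BinSpace N)) raise_mul_raise w

/-- The linear map from spinors to binary strings which intertwines exterior multiplication with
the creation operators and sends `1` to the zero string. -/
def spinorToBin (N : ℕ) : SpinorSpace N →ₗ[ℂ] BinSpace N :=
  (LinearMap.applyₗ (Finsupp.single 0 1)).comp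
    (ExteriorAlgebra.lift ℂ ⟨raiseLin N, raiseLin_mul_self⟩).toLinearMap

theorem spinorToBin_algebraMap (r : ℂ) :
    spinorToBin N (algebraMap ℂ _ r) = Finsupp.single 0 r := by
  simp [spinorToBin, Module.algebraMap_end_apply]

theorem spinorToBin_ι_mul (w : Fin N → ℂ) (x : SpinorSpace N) :
    spinorToBin N (ExteriorAlgebra.ι ℂ w * x) = raiseLin N w (spinorToBin N x) := by
  simp [spinorToBin]

theorem raiseLin_single (i : Fin N) : raiseLin N (Pi.single i 1) = raise i := by
  simp [raiseLin_apply, Pi.single_apply]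

theorem lower_mul_raiseLin (i : Fin N) (w : Fin N → ℂ) :
    lower i * raiseLin N w = w i • 1 - raiseLin N w * lower i := by
  refine (eq_sub_iff_add_eq (G := Module.End ℂ (BinSpace N))).2 ?_
  rw [raiseLin_apply, Finset.mul_sum, Finset.sum_mul, ← Finset.sum_add_distrib]
  simp [← smul_add, lower_mul_raise]

theorem mul_sum_smul_eq_neg {A ι : Type*} [Fintype ι] [Ring A] [Algebra ℂ A] {p : A} {a : ι → A}
    (h : ∀ i, p * a i = -(a i * p)) (w : ι → ℂ) :
    p * ∑ i, w i • a i = -((∑ i, w i • a i) * p) := by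
  simp [Finset.mul_sum, Finset.sum_mul, h]

theorem parity_mul_raiseLin (w : Fin N → ℂ) :
    parity * raiseLin N w = -(raiseLin N w * parity) :=
  mul_sum_smul_eq_neg (A := Module.End ℂ (BinSpace N)) parity_mul_raise w

/-- Contraction and `lower i` obey the same recursion: both kill the vacuum, and both pass a
creation operator with a sign and the scalar `w i`. -/
theorem spinorToBin_contractLeft (i : Fin N) (x : SpinorSpace N) :
    spinorToBin N (CliffordAlgebra.contractLeft (LinearMap.proj i : Module.Dual ℂ (Fin N → ℂ)) x) =
      lower i (spinorToBin N x) := by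
  induction x using CliffordAlgebra.left_induction with
  | algebraMap r =>
    rw [CliffordAlgebra.contractLeft_algebraMap, map_zero]
    erw [spinorToBin_algebraMap]
    simp [lower_single]
  | add x y hx hy => simp only [map_add, hx, hy]
  | ι_mul x m hx =>
    have h := LinearMap.congr_fun (lower_mul_raiseLin i m) (spinorToBin N x)
    rw [CliffordAlgebra.contractLeft_ι_mul, map_sub, map_smul]
    erw [spinorToBin_ι_mul, spinorToBin_ι_mul]
    rw [hx]
    exact h.symm

theorem spinorToBin_involute (x : SpinorSpace N) :
    spinorToBin N (CliffordAlgebra.involute x) = parity (spinorToBin N x) := by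
  induction x using CliffordAlgebra.left_induction with
  | algebraMap r =>
    rw [AlgHom.commutes]
    erw [spinorToBin_algebraMap]
    simp [parity_single, digitSign]
  | add x y hx hy => simp only [map_add, hx, hy]
  | ι_mul x m hx =>
    have h := LinearMap.congr_fun (parity_mul_raiseLin m) (spinorToBin N x)
    rw [map_mul, CliffordAlgebra.involute_ι, neg_mul, map_neg]
    erw [spinorToBin_ι_mul, spinorToBin_ι_mul]
    rw [hx]
    exact h.symm

theorem single_mem_range_spinorToBin (s : Finset (Fin N)) :
    Finsupp.single (fun i => if i ∈ s then 1 else 0 : BinStr N) (1 : ℂ) ∈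
      LinearMap.range (spinorToBin N) := by
  induction s using Finset.induction_on with
  | empty => exact ⟨algebraMap ℂ _ 1, by rw [spinorToBin_algebraMap]; rfl⟩
  | insert i s hi ih =>
    obtain ⟨x, hx⟩ := ih
    set m : BinStr N := fun i => if i ∈ s then 1 else 0 with hm
    -- The scalar cancels the sign that `raise i` produces, since it squares to 1.
    refine ⟨upperSign i m • (ExteriorAlgebra.ι ℂ (Pi.single i 1) * x), ?_⟩
    rw [map_smul, spinorToBin_ι_mul, raiseLin_single, hx, raise_single, if_pos (by simp [hm, hi]),
      one_mul, Finsupp.smul_single, smul_eq_mul, upperSign_mul_self]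
    congr 1
    funext j
    by_cases hj : j = i
    · subst hj; simp
    · simp [hj, hm]

theorem spinorToBin_surjective : Function.Surjective (spinorToBin N) := by
  rw [← LinearMap.range_eq_top, eq_top_iff, ← Finsupp.basisSingleOne.span_eq, Submodule.span_le]
  rintro _ ⟨m, rfl⟩
  rw [Finsupp.coe_basisSingleOne]
  convert! single_mem_range_spinorToBin (Finset.univ.filter fun i => m i = 1) using 3 with i
  by_cases h : m i = 1
  · simp [h]
  · simpa [h] using (by omega : m i = 0)

theorem finrank_spinorSpace : Module.finrank ℂ (SpinorSpace N) = 2 ^ N := by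
  rw [Module.finrank_eq_card_basis (Pi.basisFun ℂ (Fin N)).ExteriorAlgebra]
  simp

instance : FiniteDimensional ℂ (SpinorSpace N) :=
  Module.Finite.of_basis (Pi.basisFun ℂ (Fin N)).ExteriorAlgebra

/-- The linear isomorphism between spinors and binary strings. -/
def spinorEquivBin (N : ℕ) : SpinorSpace N ≃ₗ[ℂ] BinSpace N :=
  LinearEquiv.ofBijective (spinorToBin N)
    -- Both sides have dimension `2 ^ N`, so surjectivity suffices.
    ⟨(LinearMap.injective_iff_surjective_of_finrank_eq_finrank (by
      rw [finrank_spinorSpace, Module.finrank_finsupp_self]; simp)).2 spinorToBin_surjective,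
      spinorToBin_surjective⟩

/-! ### Lie algebras generated by quadratic elements of a Clifford algebra -/

/-- The odd element `G` passes the even product `b' * a` without net sign, so the bracket reduces to
the anticommutator of `a` and `b`. This is how a hop moves `b * G` to `b' * G`. -/
theorem lie_creation_step {A : Type*} [Ring A] {b' a b G : A} (hb : b * b' = -(b' * b))
    (hab : a * b + b * a = 1)
    (hGb : G * b' = -(b' * G)) (hGa : G * a = -(a * G)) : ⁅b' * a, b * G⁆ = b' * G := by
  have h1 : b * G * (b' * a) = -(b' * (b * a) * G) := by
    calc b * G * (b' * a) = b * (G * b') * a := by noncomm_ring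
      _ = -(b * b' * (G * a)) := by rw [hGb]; noncomm_ring
      _ = b * b' * (a * G) := by rw [hGa]; noncomm_ring
      _ = -(b' * (b * a) * G) := by rw [hb]; noncomm_ring
  calc ⁅b' * a, b * G⁆ = b' * (a * b + b * a) * G := by
        rw [LieRing.of_associative_ring_bracket, h1]; noncomm_ring
    _ = b' * G := by rw [hab, mul_one]

theorem lie_annihilation_step {A : Type*} [Ring A] {a' a b G : A} (ha : a' * a = -(a * a'))
    (hab : a * b + b * a = 1)
    (hGb : G * b = -(b * G)) (hGa : G * a' = -(a' * G)) : ⁅b * a', a * G⁆ = -(a' * G) := by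
  have h1 : a * G * (b * a') = a * b * a' * G := by
    calc a * G * (b * a') = a * (G * b) * a' := by noncomm_ring
      _ = -(a * b * (G * a')) := by rw [hGb]; noncomm_ring
      _ = a * b * a' * G := by rw [hGa]; noncomm_ring
  calc ⁅b * a', a * G⁆ = b * (a' * a) * G - a * b * a' * G := by
        rw [LieRing.of_associative_ring_bracket, h1]; noncomm_ring
    _ = -((a * b + b * a) * a' * G) := by rw [ha]; noncomm_ring
    _ = -(a' * G) := by rw [hab, one_mul]

section Clifford

variable {A : Type*} [Ring A] [Algebra ℂ A]

/-- A family of elements of an algebra satisfying the Clifford relations. -/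
def IsCliffordFamily {n : ℕ} (g : Fin n → A) : Prop :=
  ∀ i j, g i * g j + g j * g i = algebraMap ℂ A (if i = j then 2 else 0)

/-- The creation elements of a Clifford family. -/
def creation (g : Fin (2 * N + 1) → A) (k : Fin N) : A :=
  (1 / 2 : ℂ) • (g (evenIdx k) - Complex.I • g (oddIdx k))

/-- The annihilation elements of a Clifford family. -/
def annihilation (g : Fin (2 * N + 1) → A) (k : Fin N) : A :=
  (1 / 2 : ℂ) • (g (evenIdx k) + Complex.I • g (oddIdx k))

theorem evenIdx_eq_iff {k l : Fin N} : evenIdx k = evenIdx l ↔ k = l := by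
  simp [evenIdx, Fin.ext_iff]

theorem oddIdx_eq_iff {k l : Fin N} : oddIdx k = oddIdx l ↔ k = l := by
  simp [oddIdx, Fin.ext_iff]

theorem evenIdx_ne_oddIdx (k l : Fin N) : evenIdx k ≠ oddIdx l := by
  simp only [evenIdx, oddIdx, ne_eq, Fin.ext_iff]; omega

theorem evenIdx_ne_last (k : Fin N) : evenIdx k ≠ Fin.last (2 * N) := by
  simp only [evenIdx, ne_eq, Fin.ext_iff, Fin.val_last]; omega

theorem oddIdx_ne_last (k : Fin N) : oddIdx k ≠ Fin.last (2 * N) := by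
  simp only [oddIdx, ne_eq, Fin.ext_iff, Fin.val_last]; omega

theorem eq_evenIdx_or_oddIdx {i : Fin (2 * N + 1)} (hi : i ≠ Fin.last (2 * N)) :
    ∃ k : Fin N, i = evenIdx k ∨ i = oddIdx k := by
  have h := i.isLt
  have h' : (i : ℕ) ≠ 2 * N := fun e => hi (Fin.ext e)
  refine ⟨⟨(i : ℕ) / 2, by omega⟩, ?_⟩
  simp only [evenIdx, oddIdx, Fin.ext_iff]
  omega

theorem creation_add_annihilation (g : Fin (2 * N + 1) → A) (k : Fin N) :
    creation g k + annihilation g k = g (evenIdx k) := by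
  unfold creation annihilation; module

theorem creation_sub_annihilation (g : Fin (2 * N + 1) → A) (k : Fin N) :
    Complex.I • (creation g k - annihilation g k) = g (oddIdx k) := by
  unfold creation annihilation
  have : Complex.I • ((1 / 2 : ℂ) • (g (evenIdx k) - Complex.I • g (oddIdx k)) -
      (1 / 2 : ℂ) • (g (evenIdx k) + Complex.I • g (oddIdx k))) =
      (-(Complex.I * Complex.I)) • g (oddIdx k) := by module
  rw [this, Complex.I_mul_I, neg_neg, one_smul]

theorem creation_eq_and_annihilation_eq {g : Fin (2 * N + 1) → A} {k : Fin N} {x y : A}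
    (h1 : g (evenIdx k) = x + y) (h2 : g (oddIdx k) = Complex.I • (x - y)) :
    creation g k = x ∧ annihilation g k = y := by
  rw [creation, annihilation, h1, h2, smul_smul, Complex.I_mul_I]
  exact ⟨by module, by module⟩

namespace IsCliffordFamily

section

variable {n : ℕ} {g : Fin n → A}

theorem mul_of_ne (hg : IsCliffordFamily g) {i j : Fin n} (h : i ≠ j) :
    g i * g j = -(g j * g i) := by
  have := hg i j
  rw [if_neg h, map_zero] at this
  exact eq_neg_of_add_eq_zero_left this

theorem mul_self (hg : IsCliffordFamily g) (i : Fin n) : g i * g i = 1 := by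
  have := hg i i
  rw [if_pos rfl, ← two_smul ℂ, Algebra.algebraMap_eq_smul_one] at this
  exact smul_right_injective A (two_ne_zero (α := ℂ)) this

/-- The anticommutator of the sum with `g j` is the scalar `2 * v j`. -/
theorem eq_zero_of_sum_smul_eq_zero [Nontrivial A] (hg : IsCliffordFamily g) {v : Fin n → ℂ}
    (hv : ∑ i, v i • g i = 0) (j : Fin n) : v j = 0 := by
  have h : (∑ i, v i • g i) * g j + g j * ∑ i, v i • g i = algebraMap ℂ A (v j * 2) := by
    rw [Finset.sum_mul, Finset.mul_sum, ← Finset.sum_add_distrib]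
    have e : ∀ i, v i • g i * g j + g j * v i • g i =
        algebraMap ℂ A (v i * if i = j then 2 else 0) := fun i => by
      rw [smul_mul_assoc, mul_smul_comm, ← smul_add, hg i j, map_mul, Algebra.smul_def]
    simp only [e, ← map_sum]
    simp
  rw [hv, zero_mul, mul_zero, add_zero] at h
  simpa using (algebraMap ℂ A).injective (h.symm.trans (map_zero _).symm)

/-- The anticommutator of two linear combinations of the elements of a Clifford family. -/
theorem anticomm_pair (hg : IsCliffordFamily g) {i j k l : Fin n} (c d : ℂ) (r : ℂ)
    (h : (if i = k then 1 else 0) + d * (if i = l then 1 else 0) + c * (if j = k then 1 else 0) +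
      c * d * (if j = l then 1 else 0) = 2 * r) :
    ((1 / 2 : ℂ) • (g i + c • g j)) * ((1 / 2 : ℂ) • (g k + d • g l)) +
      ((1 / 2 : ℂ) • (g k + d • g l)) * ((1 / 2 : ℂ) • (g i + c • g j)) = algebraMap ℂ A r := by
  have e : ∀ i j, g i * g j + g j * g i = (if i = j then (1 : ℂ) else 0) • (2 : ℂ) • (1 : A) := by
    intro i j
    rw [hg i j, Algebra.algebraMap_eq_smul_one]
    split_ifs <;> simp
  have e' : ((1 / 2 : ℂ) • (g i + c • g j)) * ((1 / 2 : ℂ) • (g k + d • g l)) +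
      ((1 / 2 : ℂ) • (g k + d • g l)) * ((1 / 2 : ℂ) • (g i + c • g j)) =
      (1 / 4 : ℂ) • ((g i * g k + g k * g i) + d • (g i * g l + g l * g i) +
        c • (g j * g k + g k * g j) + (c * d) • (g j * g l + g l * g j)) := by
    simp only [add_mul, mul_add, smul_mul_assoc, mul_smul_comm]
    module
  rw [e', e, e, e, e, Algebra.algebraMap_eq_smul_one]
  have : r = (1 / 2) * ((if i = k then 1 else 0) + d * (if i = l then 1 else 0) +
    c * (if j = k then 1 else 0) + c * d * (if j = l then 1 else 0)) := by rw [h]; ring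
  rw [this]
  module

end

variable {g : Fin (2 * N + 1) → A}

theorem annihilation_mul_creation (hg : IsCliffordFamily g) (k : Fin N) :
    annihilation g k * creation g k + creation g k * annihilation g k = 1 := by
  -- The coefficients are `c = I` and `d = -I`, so the even and odd squares each contribute 1 and
  -- the mixed terms vanish.
  rw [creation, sub_eq_add_neg, ← neg_smul, annihilation, hg.anticomm_pair _ _ 1, map_one]
  simp only [evenIdx_ne_oddIdx, (evenIdx_ne_oddIdx _ _).symm, if_true, if_false]
  linear_combination -Complex.I_mul_I

theorem creation_mul_creation (hg : IsCliffordFamily g) {k l : Fin N} (h : k ≠ l) :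
    creation g k * creation g l = -(creation g l * creation g k) := by
  refine eq_neg_of_add_eq_zero_left ?_
  rw [creation, creation, sub_eq_add_neg, sub_eq_add_neg, ← neg_smul, ← neg_smul,
    hg.anticomm_pair _ _ 0, map_zero]
  simp [evenIdx_ne_oddIdx, (evenIdx_ne_oddIdx _ _).symm, evenIdx_eq_iff, oddIdx_eq_iff, h]

theorem annihilation_mul_annihilation (hg : IsCliffordFamily g) {k l : Fin N} (h : k ≠ l) :
    annihilation g k * annihilation g l = -(annihilation g l * annihilation g k) := by
  refine eq_neg_of_add_eq_zero_left ?_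
  rw [annihilation, annihilation, hg.anticomm_pair _ _ 0, map_zero]
  simp [evenIdx_ne_oddIdx, (evenIdx_ne_oddIdx _ _).symm, evenIdx_eq_iff, oddIdx_eq_iff, h]

theorem last_mul_creation (hg : IsCliffordFamily g) (k : Fin N) :
    g (Fin.last _) * creation g k = -(creation g k * g (Fin.last _)) := by
  simp [creation, mul_sub, sub_mul, hg.mul_of_ne (evenIdx_ne_last k).symm,
    hg.mul_of_ne (oddIdx_ne_last k).symm, smul_sub, neg_add_eq_sub]

theorem last_mul_annihilation (hg : IsCliffordFamily g) (k : Fin N) :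
    g (Fin.last _) * annihilation g k = -(annihilation g k * g (Fin.last _)) := by
  simp [annihilation, mul_add, add_mul, hg.mul_of_ne (evenIdx_ne_last k).symm,
    hg.mul_of_ne (oddIdx_ne_last k).symm, smul_add, neg_add_rev, add_comm]

/-- Induction on the position: bracketing with the hop between `k` and `k + 1` carries the elements
up one step. -/
theorem mul_last_mem [NeZero N] (hg : IsCliffordFamily g) {L : LieSubalgebra ℂ A}
    (hb : creation g 0 * g (Fin.last _) ∈ L) (ha : annihilation g 0 * g (Fin.last _) ∈ L)
    (hpos : ∀ i j : Fin N, (j : ℕ) = i + 1 → creation g j * annihilation g i ∈ L)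
    (hneg : ∀ i j : Fin N, (j : ℕ) = i + 1 → creation g i * annihilation g j ∈ L) (k : Fin N) :
    creation g k * g (Fin.last _) ∈ L ∧ annihilation g k * g (Fin.last _) ∈ L := by
  obtain ⟨k, hk⟩ := k
  induction k with
  | zero => exact ⟨hb, ha⟩
  | succ k ih =>
    obtain ⟨h1, h2⟩ := ih (Nat.lt_of_succ_lt hk)
    have hne : (⟨k, Nat.lt_of_succ_lt hk⟩ : Fin N) ≠ ⟨k + 1, hk⟩ := by simp
    refine ⟨?_, ?_⟩
    · rw [← lie_creation_step (hg.creation_mul_creation hne) (hg.annihilation_mul_creation _)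
        (hg.last_mul_creation _) (hg.last_mul_annihilation _)]
      exact L.lie_mem (hpos _ _ rfl) h1
    · rw [← neg_neg (annihilation g _ * _),
        ← lie_annihilation_step (hg.annihilation_mul_annihilation hne.symm)
        (hg.annihilation_mul_creation _) (hg.last_mul_creation _) (hg.last_mul_annihilation _)]
      exact L.neg_mem (L.lie_mem (hneg _ _ rfl) h2)

theorem mul_mem [NeZero N] (hg : IsCliffordFamily g) {L : LieSubalgebra ℂ A}
    (hb : creation g 0 * g (Fin.last _) ∈ L) (ha : annihilation g 0 * g (Fin.last _) ∈ L)
    (hpos : ∀ i j : Fin N, (j : ℕ) = i + 1 → creation g j * annihilation g i ∈ L)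
    (hneg : ∀ i j : Fin N, (j : ℕ) = i + 1 → creation g i * annihilation g j ∈ L)
    {i j : Fin (2 * N + 1)} (hij : i ≠ j) : g i * g j ∈ L := by
  have hlast : ∀ i, i ≠ Fin.last (2 * N) → g i * g (Fin.last _) ∈ L := by
    intro i hi
    obtain ⟨k, rfl | rfl⟩ := eq_evenIdx_or_oddIdx hi <;>
      obtain ⟨h1, h2⟩ := hg.mul_last_mem hb ha hpos hneg k
    · rw [← creation_add_annihilation g, add_mul]
      exact L.add_mem h1 h2
    · rw [← creation_sub_annihilation g, smul_mul_assoc, sub_mul]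
      exact L.smul_mem _ (L.sub_mem h1 h2)
  by_cases hj : j = Fin.last _
  · subst hj; exact hlast i hij
  by_cases hi : i = Fin.last _
  · subst hi
    rw [hg.mul_of_ne hij]
    exact L.neg_mem (hlast j hj)
  -- Moving the inner `g (Fin.last _)` past `g j` costs a sign, and then its square is 1; the two
  -- halves of the bracket add up because `g i` and `g j` anticommute.
  have hbr : ⁅g i * g (Fin.last _), g j * g (Fin.last _)⁆ = (-2 : ℂ) • (g i * g j) := by
    have e : ∀ i j, j ≠ Fin.last (2 * N) →
        g i * g (Fin.last _) * (g j * g (Fin.last _)) = -(g i * g j) := by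
      intro i j hj
      calc _ = g i * (g (Fin.last _) * g j) * g (Fin.last _) := by noncomm_ring
        _ = -(g i * g j * (g (Fin.last _) * g (Fin.last _))) := by
          rw [hg.mul_of_ne (Ne.symm hj)]; noncomm_ring
        _ = -(g i * g j) := by rw [hg.mul_self, mul_one]
    rw [LieRing.of_associative_ring_bracket, e i j hj, e j i hi, hg.mul_of_ne hij.symm]
    module
  have := L.smul_mem (-1 / 2 : ℂ) (L.lie_mem (hlast i hi) (hlast j hj))
  rw [hbr, smul_smul] at this
  convert this using 1
  norm_num

end IsCliffordFamily

end Clifford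

/-! ### The image of the spin representation -/

/-- The operator on spinors of the `i`-th standard basis vector. -/
def gamma (N : ℕ) (i : Fin (2 * N + 1)) : Module.End ℂ (SpinorSpace N) :=
  cliffordRep N (cliffBasis i)

theorem isCliffordFamily_gamma : IsCliffordFamily (gamma N) := by
  intro i j
  rw [gamma, gamma, ← map_mul, ← map_mul, ← map_add, cliffBasis_swap, AlgHom.commutes]

theorem spinRep_apply (X : LieAlgebra.Orthogonal.so (Fin (2 * N + 1)) ℂ) :
    spinRep N X = (1 / 4 : ℂ) • ∑ i, ∑ j, X.1 i j • (gamma N i * gamma N j) := by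
  have : spinRep N X = cliffordRep N (spinLin _ X.1) := rfl
  rw [this, spinLin_apply]
  simp only [map_smul, map_sum, map_mul, gamma]

theorem gamma_mul_gamma_mem_range {i j : Fin (2 * N + 1)} (hij : i ≠ j) :
    gamma N i * gamma N j ∈ (spinRep N).range := by
  -- The entries `±2` offset the factor `1/4`: the two anticommuting orders each contribute half of
  -- the product.
  refine ⟨⟨Matrix.single i j 2 - Matrix.single j i 2, ?_⟩, ?_⟩
  · rw [LieAlgebra.Orthogonal.mem_so]
    simp
  · refine (spinRep_apply _).trans ?_
    have e : ∀ a b : Fin (2 * N + 1), ∑ k, ∑ l, Matrix.single a b (2 : ℂ) k l •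
        (gamma N k * gamma N l) = (2 : ℂ) • (gamma N a * gamma N b) := by
      intro a b
      rw [Finset.sum_eq_single a, Finset.sum_eq_single b]
      · simp
      · intro l _ hl; simp [Matrix.single, hl.symm]
      · simp
      · intro k _ hk; simp [Matrix.single, hk.symm]
      · simp
    simp only [Matrix.sub_apply, sub_smul, Finset.sum_sub_distrib, e]
    rw [isCliffordFamily_gamma.mul_of_ne hij.symm]
    module

theorem so_apply_self {n : ℕ} (X : LieAlgebra.Orthogonal.so (Fin n) ℂ) (i : Fin n) :
    X.1 i i = 0 := by
  have h := congrFun (congrFun ((LieAlgebra.Orthogonal.mem_so _ _ _).1 X.2) i) i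
  simpa [self_eq_neg] using h

theorem range_spinRep_le {L : LieSubalgebra ℂ (Module.End ℂ (SpinorSpace N))}
    (h : ∀ i j, i ≠ j → gamma N i * gamma N j ∈ L) : (spinRep N).range ≤ L := by
  rintro _ ⟨X, rfl⟩
  change spinRep N X ∈ L
  rw [spinRep_apply]
  refine L.smul_mem _ (sum_mem fun i _ => sum_mem fun j _ => ?_)
  by_cases hij : i = j
  · subst hij
    rw [so_apply_self, zero_smul]
    exact L.zero_mem
  · exact L.smul_mem _ (h i j hij)

/-- The commutator of the Clifford element of `X` with the `k`-th basis vector is column `k` of `X`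
expanded in that basis. If `X` acts by zero, each column gives a vanishing combination of gammas,
which are linearly independent. -/
theorem spinRep_injective : Function.Injective (spinRep N) := by
  refine (injective_iff_map_eq_zero _).2 fun X hX => ?_
  have hX' : cliffordRep N (spinLin _ X.1) = 0 := hX
  refine Subtype.ext (Matrix.ext fun j k => ?_)
  have h1 := congrArg (cliffordRep N)
    (spinLin_lie_cliffBasis X.1 ((LieAlgebra.Orthogonal.mem_so _ _ _).1 X.2) k)
  rw [map_sub, map_mul, map_mul, hX', map_sum] at h1
  simp only [map_smul] at h1
  rw [zero_mul, mul_zero, sub_zero] at h1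
  exact isCliffordFamily_gamma.eq_zero_of_sum_smul_eq_zero (v := fun i => X.1 i k) h1.symm j

/-! ### The gamma operators as exterior multiplication, contraction and involution -/

theorem gammaLin_single (i : Fin (2 * N + 1)) : gamma N i = gammaLin N (Pi.single i 1) := by
  simp [gamma, cliffordRep, cliffBasis]

theorem gamma_evenIdx (k : Fin N) : gamma N (evenIdx k) =
    LinearMap.mulLeft ℂ (ExteriorAlgebra.ι ℂ (Pi.single k 1)) +
      CliffordAlgebra.contractLeft (LinearMap.proj k : Module.Dual ℂ (Fin N → ℂ)) := by
  have h1 : isoW N (Pi.single (evenIdx k) 1) = Pi.single k 1 := by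
    ext l
    simp [isoW, Pi.single_apply, evenIdx_eq_iff, (evenIdx_ne_oddIdx _ _).symm]
  have h2 : isoWDual N (Pi.single (evenIdx k) 1) = LinearMap.proj k := by
    ext l
    simp [isoWDual, Pi.single_apply, evenIdx_eq_iff, (evenIdx_ne_oddIdx _ _).symm]
  rw [gammaLin_single]
  change cliffordOp _ _ _ = _
  rw [h1, h2, Pi.single_eq_of_ne (evenIdx_ne_last k).symm, cliffordOp, zero_smul]
  exact add_zero _

theorem gamma_oddIdx (k : Fin N) : gamma N (oddIdx k) =
    Complex.I • (LinearMap.mulLeft ℂ (ExteriorAlgebra.ι ℂ (Pi.single k 1)) -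
      CliffordAlgebra.contractLeft (LinearMap.proj k : Module.Dual ℂ (Fin N → ℂ))) := by
  have h1 : isoW N (Pi.single (oddIdx k) 1) = Complex.I • Pi.single k 1 := by
    ext l
    simp [isoW, Pi.single_apply, oddIdx_eq_iff, evenIdx_ne_oddIdx]
  have h2 : isoWDual N (Pi.single (oddIdx k) 1) = -Complex.I • LinearMap.proj k := by
    ext l
    simp [isoWDual, Pi.single_apply, oddIdx_eq_iff, evenIdx_ne_oddIdx]
  rw [gammaLin_single]
  change cliffordOp _ _ _ = _
  rw [h1, h2, Pi.single_eq_of_ne (oddIdx_ne_last k).symm, cliffordOp, zero_smul]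
  refine LinearMap.ext fun x => ?_
  simp
  module

theorem gamma_last :
    gamma N (Fin.last _) =
      (CliffordAlgebra.involute.toLinearMap : Module.End ℂ (SpinorSpace N)) := by
  have h1 : isoW N (Pi.single (Fin.last _) 1) = 0 := by
    ext l
    simp [isoW, evenIdx_ne_last, oddIdx_ne_last]
  have h2 : isoWDual N (Pi.single (Fin.last _) 1) = 0 := by
    ext l
    simp [isoWDual, evenIdx_ne_last, oddIdx_ne_last]
  rw [gammaLin_single]
  change cliffordOp _ _ _ = _
  rw [h1, h2, Pi.single_eq_same, cliffordOp]
  refine LinearMap.ext fun x => ?_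
  simp

theorem creation_gamma (k : Fin N) : creation (gamma N) k =
    LinearMap.mulLeft ℂ (ExteriorAlgebra.ι ℂ (Pi.single k 1)) :=
  (creation_eq_and_annihilation_eq (gamma_evenIdx k) (gamma_oddIdx k)).1

theorem annihilation_gamma (k : Fin N) : annihilation (gamma N) k =
    CliffordAlgebra.contractLeft (LinearMap.proj k : Module.Dual ℂ (Fin N → ℂ)) :=
  (creation_eq_and_annihilation_eq (gamma_evenIdx k) (gamma_oddIdx k)).2

/-! ### Transport along the isomorphism of spinors and binary strings -/

/-- The isomorphism of endomorphism Lie algebras induced by `spinorEquivBin`. -/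
def endEquiv (N : ℕ) : Module.End ℂ (BinSpace N) ≃ₗ⁅ℂ⁆ Module.End ℂ (SpinorSpace N) :=
  (spinorEquivBin N).symm.lieConj

theorem endEquiv_eq_of_intertwine {f : Module.End ℂ (BinSpace N)}
    {f' : Module.End ℂ (SpinorSpace N)}
    (h : ∀ x, spinorToBin N (f' x) = f (spinorToBin N x)) : endEquiv N f = f' := by
  refine LinearMap.ext fun x => ?_
  change (spinorEquivBin N).symm (f (spinorToBin N x)) = f' x
  rw [← h]
  exact (spinorEquivBin N).symm_apply_apply (f' x)

theorem spinorToBin_creation (i : Fin N) (x : SpinorSpace N) :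
    spinorToBin N (creation (gamma N) i x) = raise i (spinorToBin N x) := by
  rw [creation_gamma, LinearMap.mulLeft_apply, spinorToBin_ι_mul, raiseLin_single]

theorem spinorToBin_annihilation (i : Fin N) (x : SpinorSpace N) :
    spinorToBin N (annihilation (gamma N) i x) = lower i (spinorToBin N x) := by
  rw [annihilation_gamma]
  exact spinorToBin_contractLeft i x

theorem spinorToBin_gamma_last (x : SpinorSpace N) :
    spinorToBin N (gamma N (Fin.last _) x) = parity (spinorToBin N x) := by
  rw [gamma_last]
  exact spinorToBin_involute x

theorem endEquiv_raise_mul_lower (i j : Fin N) :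
    endEquiv N (raise i * lower j) = creation (gamma N) i * annihilation (gamma N) j :=
  endEquiv_eq_of_intertwine fun x => by
    simp only [Module.End.mul_apply, spinorToBin_creation, spinorToBin_annihilation]

theorem endEquiv_raise_mul_parity (i : Fin N) :
    endEquiv N (raise i * parity) = creation (gamma N) i * gamma N (Fin.last _) :=
  endEquiv_eq_of_intertwine fun x => by
    simp only [Module.End.mul_apply, spinorToBin_creation, spinorToBin_gamma_last]

theorem endEquiv_lower_mul_parity (i : Fin N) :
    endEquiv N (lower i * parity) = annihilation (gamma N) i * gamma N (Fin.last _) :=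
  endEquiv_eq_of_intertwine fun x => by
    simp only [Module.End.mul_apply, spinorToBin_annihilation, spinorToBin_gamma_last]

/-- The product expands into four products of gammas; `i ≠ j` keeps the factors distinct, so that no
scalar square appears. -/
theorem creation_mul_annihilation_mem_range {i j : Fin N} (h : i ≠ j) :
    creation (gamma N) i * annihilation (gamma N) j ∈ (spinRep N).range := by
  have h1 := gamma_mul_gamma_mem_range (mt evenIdx_eq_iff.1 h)
  have h2 := gamma_mul_gamma_mem_range (evenIdx_ne_oddIdx i j)
  have h3 := gamma_mul_gamma_mem_range (evenIdx_ne_oddIdx j i).symm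
  have h4 := gamma_mul_gamma_mem_range (mt oddIdx_eq_iff.1 h)
  rw [creation, annihilation, smul_mul_smul_comm, sub_mul, mul_add, mul_add, smul_mul_assoc,
    smul_mul_assoc, mul_smul_comm, mul_smul_comm]
  exact LieSubalgebra.smul_mem _ _ (LieSubalgebra.sub_mem _
    (LieSubalgebra.add_mem _ h1 (LieSubalgebra.smul_mem _ _ h2))
    (LieSubalgebra.add_mem _ (LieSubalgebra.smul_mem _ _ h3)
      (LieSubalgebra.smul_mem _ _ (LieSubalgebra.smul_mem _ _ h4))))

theorem creation_mul_last_mem_range (i : Fin N) :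
    creation (gamma N) i * gamma N (Fin.last _) ∈ (spinRep N).range := by
  rw [creation, smul_mul_assoc, sub_mul, smul_mul_assoc]
  exact LieSubalgebra.smul_mem _ _ (LieSubalgebra.sub_mem _
    (gamma_mul_gamma_mem_range (evenIdx_ne_last i))
    (LieSubalgebra.smul_mem _ _ (gamma_mul_gamma_mem_range (oddIdx_ne_last i))))

theorem annihilation_mul_last_mem_range (i : Fin N) :
    annihilation (gamma N) i * gamma N (Fin.last _) ∈ (spinRep N).range := by
  rw [annihilation, smul_mul_assoc, add_mul, smul_mul_assoc]
  exact LieSubalgebra.smul_mem _ _ (LieSubalgebra.add_mem _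
    (gamma_mul_gamma_mem_range (evenIdx_ne_last i))
    (LieSubalgebra.smul_mem _ _ (gamma_mul_gamma_mem_range (oddIdx_ne_last i))))

theorem Bpos_mem {k : ℕ} (h1 : 1 ≤ k) (h2 : k ≤ N) : Bpos N k ∈ oddSpinAlgebra N :=
  LieSubalgebra.subset_lieSpan ⟨k, h1, h2, .inl rfl⟩

theorem Bneg_mem {k : ℕ} (h1 : 1 ≤ k) (h2 : k ≤ N) : Bneg N k ∈ oddSpinAlgebra N :=
  LieSubalgebra.subset_lieSpan ⟨k, h1, h2, .inr rfl⟩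

theorem map_oddSpinAlgebra_le [NeZero N] :
    (oddSpinAlgebra N).map (endEquiv N : Module.End ℂ (BinSpace N) →ₗ⁅ℂ⁆ _) ≤
      (spinRep N).range := by
  rw [LieSubalgebra.map_le_iff_le_comap, oddSpinAlgebra, LieSubalgebra.lieSpan_le]
  rintro _ ⟨k, h1, h2, h⟩
  change endEquiv N _ ∈ (spinRep N).range
  obtain _ | _ | k := k
  · omega
  · rcases h with rfl | rfl
    · rw [zero_add, Bpos_one, endEquiv_raise_mul_parity]
      exact creation_mul_last_mem_range 0
    · rw [zero_add, Bneg_one]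
      refine (map_neg (endEquiv N) (lower 0 * parity)).symm ▸ neg_mem ?_
      rw [endEquiv_lower_mul_parity]
      exact annihilation_mul_last_mem_range 0
  -- The generator index is now `k + 2`, and it concerns digits `k` and `k + 1`.
  · have hne : (⟨k, by omega⟩ : Fin N) ≠ ⟨k + 1, by omega⟩ := by simp
    rcases h with rfl | rfl
    · rw [Bpos_add_two (i := ⟨k, by omega⟩) (j := ⟨k + 1, by omega⟩) rfl,
        endEquiv_raise_mul_lower]
      exact creation_mul_annihilation_mem_range hne.symm
    · rw [Bneg_add_two (i := ⟨k, by omega⟩) (j := ⟨k + 1, by omega⟩) rfl,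
        endEquiv_raise_mul_lower]
      exact creation_mul_annihilation_mem_range hne

theorem map_oddSpinAlgebra [NeZero N] :
    (oddSpinAlgebra N).map (endEquiv N : Module.End ℂ (BinSpace N) →ₗ⁅ℂ⁆ _) =
      (spinRep N).range := by
  have hN : 1 ≤ N := NeZero.one_le
  refine le_antisymm map_oddSpinAlgebra_le (range_spinRep_le fun i j hij => ?_)
  refine isCliffordFamily_gamma.mul_mem ?_ ?_ ?_ ?_ hij
  · exact ⟨_, Bpos_mem le_rfl hN, by rw [Bpos_one]; exact endEquiv_raise_mul_parity 0⟩
  -- The sign undoes the one in `Bneg_one`.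
  · refine ⟨-Bneg N 1, neg_mem (Bneg_mem le_rfl hN), ?_⟩
    have : -Bneg N 1 = lower (0 : Fin N) * parity := by
      rw [Bneg_one]; exact neg_neg (lower (0 : Fin N) * parity)
    rw [this]
    exact endEquiv_lower_mul_parity 0
  · exact fun i j h => ⟨_, Bpos_mem (k := i + 2) (by omega) (by omega), by
      rw [Bpos_add_two h]; exact endEquiv_raise_mul_lower j i⟩
  · exact fun i j h => ⟨_, Bneg_mem (k := i + 2) (by omega) (by omega), by
      rw [Bneg_add_two h]; exact endEquiv_raise_mul_lower i j⟩

end BinarySpin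

end

/-- For `N ≥ 1`, there are a Lie algebra isomorphism between `𝔤_N` and `so(2N+1, ℂ)` and a linear
isomorphism between `ℂ{0,1}^N` and the spinor space, which identify the action of `𝔤_N` on
`ℂ{0,1}^N` with the fundamental spin representation. -/
theorem mainTheorem1 (N : ℕ) (hN : 0 < N) :
    ∃ (φ : BinarySpin.oddSpinAlgebra N ≃ₗ⁅ℂ⁆ LieAlgebra.Orthogonal.so (Fin (2 * N + 1)) ℂ)
      (T : BinarySpin.BinSpace N ≃ₗ[ℂ] BinarySpin.SpinorSpace N),
      ∀ (X : BinarySpin.oddSpinAlgebra N) (v : BinarySpin.BinSpace N),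
        T ((X : Module.End ℂ (BinarySpin.BinSpace N)) v) =
          BinarySpin.spinRep N (φ X) (T v) := by
  have : NeZero N := ⟨hN.ne'⟩
  let ψ := LieEquiv.ofInjective (BinarySpin.spinRep N) BinarySpin.spinRep_injective
  let χ := LieEquiv.ofSubalgebras _ _ (BinarySpin.endEquiv N) BinarySpin.map_oddSpinAlgebra
  refine ⟨χ.trans ψ.symm, (BinarySpin.spinorEquivBin N).symm, fun X v => ?_⟩
  -- As `ψ` is `spinRep` with codomain cut down to its range, applying `spinRep` after `ψ.symm`
  -- returns the endomorphism itself.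
  have h : BinarySpin.spinRep N (ψ.symm (χ X)) = BinarySpin.endEquiv N X :=
    congrArg Subtype.val (ψ.apply_symm_apply (χ X))
  rw [LieEquiv.trans_apply, h]
  change _ = (BinarySpin.spinorEquivBin N).symm ((X : Module.End ℂ (BinarySpin.BinSpace N))
    (BinarySpin.spinorEquivBin N ((BinarySpin.spinorEquivBin N).symm v)))
  rw [LinearEquiv.apply_symm_apply]
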